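/- A lattice is a finitely generated free $\mathbf Z$-module with a symmetric $\mathbf Z$-valued bilinear form, $\cong$ denotes isometry, and $\oplus$ denotes the orthogonal direct sum. An embedding of lattices (an injective form-preserving homomorphism) is primitive if its cokernel is torsion free. Let $U$ be the hyperbolic plane, $E_8(-1)$ the negative definite $E_8$ lattice, and $\Lambda_{K3}=U\oplus U\oplus U\oplus E_8(-1)\oplus E_8(-1)$. For $b,c\in\mathbf Z$ let $\Lambda_{b,c}$ be $\mathbf Z^2$ with Gram matrix $\begin{pmatrix}0&b\\ b&2c\end{pmatrix}$, and let $\Gamma_{b,c}=\Lambda_{b,c}\oplus U\oplus E_8(-1)\oplus E_8(-1)$. 1. Let $b,c\in\mathbf Z$ with $b\neq 0$. For every primitive embedding $i:\Gamma_{b,c}\hookrightarrow\Lambda_{K3}$ there is a non-zero integer $a$, coprime to $b$, such that $i(\Gamma_{b,c})^\perp\cong\Lambda_{b,-a^2c}$. Conversely, for every non-zero integer $a$ with $\gcd(b,ac)=\gcd(b,c)$ (in particular for every non-zero $a$ coprime to $b$) there is a primitive embedding $i:\Gamma_{b,c}\hookrightarrow\Lambda_{K3}$ such that $i(\Gamma_{b,c})^\perp\cong\Lambda_{b,-a^2c}$.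 2. Let $b,c\in\mathbf Z$ with $b\ne 0$. Then $\Lambda_{b,c}\cong\Lambda_{-b,c}$, and $\Lambda_{b,c}\cong\Lambda_{b,c-nb}$ for every $n\in\mathbf Z$, and $\Lambda_{b,c}\cong\Lambda_{b,d}$ for every $d\in\mathbf Z$ with $cd\equiv 1\bmod b$. 3. Let $b,c,d\in\mathbf Z$ with $\gcd(b,c)=1$ and $0\le c<d\le b-1$. Then $\Lambda_{b,c}\cong\Lambda_{b,d}$ if and only if $cd\equiv 1\bmod b$. -/

import Mathlib

namespace K3Lattice

open LinearMap (BilinForm)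

section General

variable {M N : Type*} [AddCommGroup M] [AddCommGroup N]

/-- Two `ℤ`-modules with bilinear forms are isometric: there is a `ℤ`-linear isomorphism between
them that carries one form to the other. -/
def Isometric (B : BilinForm ℤ M) (C : BilinForm ℤ N) : Prop :=
  ∃ e : M ≃ₗ[ℤ] N, ∀ x y : M, C (e x) (e y) = B x y

/-- The orthogonal direct sum of two bilinear forms. -/
def orthSum (B : BilinForm ℤ M) (C : BilinForm ℤ N) : BilinForm ℤ (M × N) :=
  B.comp (LinearMap.fst ℤ M N) (LinearMap.fst ℤ M N) +
    C.comp (LinearMap.snd ℤ M N) (LinearMap.snd ℤ M N)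

/-- An embedding of lattices (an injective form-preserving `ℤ`-linear map) is primitive if the
cokernel is torsion free. -/
def IsPrimitiveEmbedding {B : BilinForm ℤ M} {C : BilinForm ℤ N} (i : B.Isometry C) : Prop :=
  Function.Injective i ∧ Module.IsTorsionFree ℤ (N ⧸ LinearMap.range i.toLinearMap)

/-- The form induced on the orthogonal complement of the image of a form-preserving map. -/
def imagePerp {B : BilinForm ℤ M} {C : BilinForm ℤ N} (i : B.Isometry C) :
    BilinForm ℤ (C.orthogonal (LinearMap.range i.toLinearMap)) :=
  C.restrict (C.orthogonal (LinearMap.range i.toLinearMap))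

end General

/-- The rank two lattice `Λ_{b,c}` with Gram matrix `(0, b; b, 2c)`. -/
def Lam (b c : ℤ) : BilinForm ℤ (Fin 2 → ℤ) :=
  Matrix.toBilin' !![0, b; b, 2 * c]

/-- The hyperbolic plane `U`. -/
def U : BilinForm ℤ (Fin 2 → ℤ) :=
  Matrix.toBilin' !![0, 1; 1, 0]

/-- The negative definite lattice `E₈(-1)`. -/
def negE8 : BilinForm ℤ (Fin 8 → ℤ) :=
  Matrix.toBilin' (-CartanMatrix.E₈)

/-- The lattice `Γ_{b,c} = Λ_{b,c} ⊕ U ⊕ E₈(-1) ⊕ E₈(-1)`. -/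
def Gam (b c : ℤ) :
    BilinForm ℤ ((Fin 2 → ℤ) × (Fin 2 → ℤ) × (Fin 8 → ℤ) × (Fin 8 → ℤ)) :=
  orthSum (Lam b c) (orthSum U (orthSum negE8 negE8))

/-- The K3 lattice `U ⊕ U ⊕ U ⊕ E₈(-1) ⊕ E₈(-1)`. -/
def LamK3 :
    BilinForm ℤ ((Fin 2 → ℤ) × (Fin 2 → ℤ) × (Fin 2 → ℤ) × (Fin 8 → ℤ) × (Fin 8 → ℤ)) :=
  orthSum U (orthSum U (orthSum U (orthSum negE8 negE8)))

end K3Lattice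

/-! Put `W = U ⊕ E₈(-1) ⊕ E₈(-1)`, and let `e`, `f` be the images of the basis of `Λ_{b,c}`.
Primitivity and unimodularity give a vector pairing to 1 with `e` and to 0 with `W`; by evenness a
multiple of `e` corrects it to an isotropic `v`. Then `⟨e, v⟩ ⊕ W` is unimodular and splits off, and
its complement is even unimodular of rank two and represents every functional, hence a hyperbolic
plane `⟨u₁, u₂⟩` (`exists_hyperbolic_basis`). So `f = ν e + b v + p u₁ + q u₂` with `c = b ν + p q`,
and the sought complement is the set of `y e + m u₁ + n u₂` with `b y + q m + p n = 0`. Primitivity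
gives `gcd(b, p, q) = 1`, and `exists_parametrization` solves this equation by two generators whose
Gram matrix is that of `Λ_{b,-a²c}` up to a shift of the last parameter by a multiple of `b`. The
converse runs the same normal form backwards, with `q` an inverse of `a` modulo `b`. The isometries
of part 2 are base changes. Part 3 holds because `Λ_{b,d}` has only two isotropic lines: an isometry
matching the lines in the given order forces `c ≡ d`, one exchanging them forces `c d ≡ 1`. -/

namespace K3Lattice

open LinearMap (BilinForm)

/-! ### Arithmetic: lifting units and factoring a quadratic form -/

section Integers

/-- A unit modulo a divisor `m` of `b` lifts to a unit modulo `b`. -/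
theorem exists_isCoprime_lift {b m r : ℤ} (hb : b ≠ 0) (hm : m ∣ b) (hr : IsCoprime r m) :
    ∃ a : ℤ, a ≠ 0 ∧ IsCoprime a b ∧ m ∣ a - r := by
  have : NeZero b.natAbs := ⟨by simpa using hb⟩
  have hmb : m.natAbs ∣ b.natAbs := Int.natAbs_dvd_natAbs.2 hm
  have isUnit_iff : ∀ x n : ℤ, IsUnit (x : ZMod n.natAbs) ↔ IsCoprime x n := fun x n => by
    rw [ZMod.coe_int_isUnit_iff_isCoprime, isCoprime_comm]
    rcases Int.natAbs_eq n with h | h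
    · rw [← h]
    · conv_rhs => rw [h]
      rw [IsCoprime.neg_right_iff]
  obtain ⟨z, hz⟩ := ZMod.unitsMap_surjective hmb ((isUnit_iff r m).2 hr).unit
  obtain ⟨a, ha⟩ := ZMod.intCast_surjective (z : ZMod b.natAbs)
  have hab : IsCoprime a b := (isUnit_iff a b).1 (ha ▸ z.isUnit)
  have har : m ∣ a - r := by
    have h := congrArg Units.val hz
    rw [ZMod.unitsMap_val, ← ha, IsUnit.unit_spec, ZMod.cast_intCast hmb] at h
    rw [← Int.natAbs_dvd, ← ZMod.intCast_zmod_eq_zero_iff_dvd _ m.natAbs]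
    push_cast
    rw [h, sub_self]
  -- The lift is 0 only if `b` is a unit; then `b` itself is a nonzero lift.
  by_cases h0 : a = 0
  · subst h0
    refine ⟨b, hb, ?_, ?_⟩
    · rw [isCoprime_zero_left] at hab
      exact isCoprime_self.2 hab
    · rw [zero_sub] at har
      exact dvd_add hm har
  · exact ⟨a, h0, hab, har⟩

/-- A factorization of an integral binary quadratic form of discriminant `1`. -/
theorem exists_factorization {s t h : ℤ} (H : s * t = h * (h + 1)) :
    ∃ g s' h' t' : ℤ, s = g * s' ∧ h = g * h' ∧ t = h' * t' ∧ h + 1 = s' * t' := by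
  -- The matrix with rows `(s, h)` and `(h + 1, t)` has determinant 0, so both rows are multiples,
  -- by `g` and `t'`, of one primitive vector `(s', h')`.
  by_cases h0 : s = 0 ∧ h = 0
  · obtain ⟨rfl, rfl⟩ := h0
    exact ⟨0, 1, t, 1, by simp⟩
  · obtain ⟨s', h', hs, hh, hu⟩ := extract_gcd s h
    set g := gcd s h
    have hg : g ≠ 0 := by
      intro hg
      rw [hg] at hs hh
      simp_all
    have hc : s' * t = h' * (h + 1) := by
      apply mul_left_cancel₀ hg
      rw [← mul_assoc, ← hs, H, ← mul_assoc, ← hh]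
    have hcop : IsCoprime h' s' := ((gcd_isUnit_iff s' h').1 hu).symm
    obtain ⟨t', ht⟩ : h' ∣ t := hcop.dvd_of_dvd_mul_left ⟨h + 1, hc⟩
    by_cases h'0 : h' = 0
    · subst h'0
      have hs'u : IsUnit s' := isCoprime_zero_left.1 hcop
      obtain ⟨k, hk⟩ : s' ∣ h + 1 := hs'u.dvd
      exact ⟨g, s', 0, k, hs, hh, by simpa using ht, hk⟩
    · refine ⟨g, s', h', t', hs, hh, ht, ?_⟩
      apply mul_left_cancel₀ h'0
      rw [← hc, ht]
      ring

end Integers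

/-! ### Unimodular forms, orthogonal splitting, hyperbolic planes -/

section General

variable {M N : Type*} [AddCommGroup M] [AddCommGroup N]

@[simp]
theorem orthSum_apply (B : BilinForm ℤ M) (C : BilinForm ℤ N) (x y : M × N) :
    orthSum B C x y = B x.1 y.1 + C x.2 y.2 := rfl

theorem Isometric.trans {P : Type*} [AddCommGroup P] {B : BilinForm ℤ M} {C : BilinForm ℤ N}
    {D : BilinForm ℤ P} (h : Isometric B C) (h' : Isometric C D) : Isometric B D := by
  obtain ⟨e, he⟩ := h
  obtain ⟨e', he'⟩ := h'
  exact ⟨e.trans e', fun x y => by simp [he, he']⟩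

/-- A form is unimodular if it identifies the module with its dual. -/
def IsUnimodular (B : BilinForm ℤ M) : Prop :=
  Function.Bijective B

theorem IsUnimodular.orthSum {B : BilinForm ℤ M} {C : BilinForm ℤ N} (hB : IsUnimodular B)
    (hC : IsUnimodular C) : IsUnimodular (orthSum B C) := by
  constructor
  · intro x y h
    refine Prod.ext (hB.1 (LinearMap.ext fun z => ?_)) (hC.1 (LinearMap.ext fun z => ?_))
    · simpa using LinearMap.congr_fun h (z, 0)
    · simpa using LinearMap.congr_fun h (0, z)
  · intro φ
    obtain ⟨x, hx⟩ := hB.2 (φ ∘ₗ LinearMap.inl ℤ M N)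
    obtain ⟨y, hy⟩ := hC.2 (φ ∘ₗ LinearMap.inr ℤ M N)
    refine ⟨(x, y), LinearMap.ext fun z => ?_⟩
    rw [orthSum_apply, hx, hy]
    simp [← map_add]

theorem isUnimodular_toBilin' {n : Type*} [Fintype n] [DecidableEq n] {A A' : Matrix n n ℤ}
    (h : A * A' = 1) : IsUnimodular (Matrix.toBilin' A) := by
  have h' : A' * A = 1 := mul_eq_one_comm.1 h
  have key : ∀ x y : n → ℤ, Matrix.toBilin' A x y = Matrix.vecMul x A ⬝ᵥ y := fun x y => by
    rw [Matrix.toBilin'_apply', Matrix.dotProduct_mulVec]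
  constructor
  · intro x y hxy
    have hv : Matrix.vecMul x A = Matrix.vecMul y A := by
      refine dotProduct_eq _ _ fun z => ?_
      rw [← key, ← key, hxy]
    simpa [Matrix.vecMul_vecMul, h] using congrArg (fun v => Matrix.vecMul v A') hv
  · intro φ
    refine ⟨Matrix.vecMul (fun k => φ (Pi.single k 1)) A', ?_⟩
    refine LinearMap.pi_ext' fun k => LinearMap.ext_ring ?_
    simp only [LinearMap.comp_apply, LinearMap.single_apply]
    rw [key, Matrix.vecMul_vecMul, h']
    simp

/-- A functional on a primitively embedded lattice in a unimodular lattice is represented by a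
vector of the ambient lattice. -/
theorem IsPrimitiveEmbedding.exists_dual {B : BilinForm ℤ M} {C : BilinForm ℤ N}
    [Module.Finite ℤ N] {i : B.Isometry C} (hi : IsPrimitiveEmbedding i) (hC : IsUnimodular C)
    (φ : M →ₗ[ℤ] ℤ) : ∃ v : N, ∀ x : M, C v (i x) = φ x := by
  have := hi.2
  -- The cokernel is finitely generated and torsion free, hence projective. A section `s` yields a
  -- retraction `ρ` of `N` onto the image, along which `φ` extends to `N`.
  obtain ⟨s, hs⟩ := Module.projective_lifting_property
    (LinearMap.range i.toLinearMap).mkQ LinearMap.id (Submodule.mkQ_surjective _)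
  let ρ : N →ₗ[ℤ] N := LinearMap.id - s ∘ₗ (LinearMap.range i.toLinearMap).mkQ
  have hρ : ∀ y, ρ y ∈ LinearMap.range i.toLinearMap := fun y => by
    rw [← Submodule.ker_mkQ (LinearMap.range i.toLinearMap), LinearMap.mem_ker]
    have := LinearMap.congr_fun hs (Submodule.mkQ _ y)
    simp only [LinearMap.comp_apply, LinearMap.id_apply] at this
    simp only [ρ, map_sub, LinearMap.sub_apply, LinearMap.comp_apply, LinearMap.id_apply, this,
      sub_self]
  let e := LinearEquiv.ofInjective i.toLinearMap hi.1
  obtain ⟨v, hv⟩ := hC.2 (φ ∘ₗ e.symm.toLinearMap ∘ₗ ρ.codRestrict _ hρ)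
  refine ⟨v, fun x => ?_⟩
  rw [hv]
  have : ρ.codRestrict _ hρ (i x) = e x := by
    apply Subtype.ext
    have h0 : (LinearMap.range i.toLinearMap).mkQ (i x) = 0 := by
      rw [← LinearMap.mem_ker, Submodule.ker_mkQ]
      exact ⟨x, rfl⟩
    simp only [ρ, LinearMap.codRestrict_apply, LinearMap.sub_apply, LinearMap.comp_apply, h0]
    simp [e]
  simp [this]

theorem mem_orthogonal_range {B : BilinForm ℤ M} {C : BilinForm ℤ N} {i : B.Isometry C} {x : N} :
    x ∈ C.orthogonal (LinearMap.range i.toLinearMap) ↔ ∀ m, C (i m) x = 0 := by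
  rw [BilinForm.mem_orthogonal_iff]
  exact ⟨fun h m => h _ ⟨m, rfl⟩, by rintro h _ ⟨m, rfl⟩; exact h m⟩

/-- A unimodular sublattice is an orthogonal direct summand. -/
theorem exists_orthogonal_projection {B : BilinForm ℤ M} {C : BilinForm ℤ N}
    (hB : IsUnimodular B) (hs : ∀ x y, C x y = C y x) (j : B.Isometry C) :
    ∃ π : N →ₗ[ℤ] M, (∀ x m, C x (j m) = B (π x) m) ∧
      ∀ x, x - j (π x) ∈ C.orthogonal (LinearMap.range j.toLinearMap) := by
  let e := LinearEquiv.ofBijective B hB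
  let r : N →ₗ[ℤ] (M →ₗ[ℤ] ℤ) := C.compl₂ j.toLinearMap
  have h : ∀ x m, C x (j m) = B (e.symm (r x)) m := fun x m => by
    change _ = e (e.symm (r x)) m
    rw [e.apply_symm_apply]
    rfl
  refine ⟨e.symm.toLinearMap ∘ₗ r, h, fun x => mem_orthogonal_range.2 fun m => ?_⟩
  rw [hs, map_sub, LinearMap.sub_apply, h, j.map_app]
  simp

/-- The orthogonal complement of a unimodular sublattice of a unimodular lattice represents every
functional. -/
theorem restrict_orthogonal_surjective {B : BilinForm ℤ M} {C : BilinForm ℤ N}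
    (hB : IsUnimodular B) (hC : IsUnimodular C) (hs : ∀ x y, C x y = C y x) (j : B.Isometry C) :
    Function.Surjective (C.restrict (C.orthogonal (LinearMap.range j.toLinearMap))) := by
  intro φ
  obtain ⟨π, hπ, hmem⟩ := exists_orthogonal_projection hB hs j
  let ρ : N →ₗ[ℤ] N := LinearMap.id - j.toLinearMap ∘ₗ π
  obtain ⟨v, hv⟩ := hC.2 (φ ∘ₗ ρ.codRestrict _ hmem)
  refine ⟨⟨_, hmem v⟩, LinearMap.ext fun n => ?_⟩
  have hn : ∀ m, C (j m) n = 0 := mem_orthogonal_range.1 n.2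
  have hπn : π n = 0 := hB.1 (LinearMap.ext fun m => by rw [← hπ, hs, hn]; simp)
  have hρn : ρ.codRestrict _ hmem n = n := by
    apply Subtype.ext
    simp [ρ, hπn]
  change C (v - j (π v)) n = φ n
  rw [map_sub, LinearMap.sub_apply, hn, hv, sub_zero, LinearMap.comp_apply, hρn]

/-- The orthogonal projection identifies `N` with the direct sum of `M` and the complement. -/
theorem finrank_add_finrank_orthogonal {B : BilinForm ℤ M} {C : BilinForm ℤ N}
    [Module.Free ℤ M] [Module.Finite ℤ M] [Module.Free ℤ N] [Module.Finite ℤ N]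
    (hB : IsUnimodular B) (hs : ∀ x y, C x y = C y x) (j : B.Isometry C) :
    Module.finrank ℤ M +
      Module.finrank ℤ (C.orthogonal (LinearMap.range j.toLinearMap)) = Module.finrank ℤ N := by
  obtain ⟨π, hπ, hmem⟩ := exists_orthogonal_projection hB hs j
  rw [← Module.finrank_prod]
  refine LinearEquiv.finrank_eq (LinearEquiv.ofBijective
    (j.toLinearMap.coprod (Submodule.subtype _)) ⟨?_, ?_⟩)
  · rw [injective_iff_map_eq_zero]
    rintro ⟨m, n⟩ h
    replace h : j m + (n : N) = 0 := h
    have hn : ∀ m, C (j m) n = 0 := mem_orthogonal_range.1 n.2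
    have hm : m = 0 := hB.1 (LinearMap.ext fun m' => by
      have := LinearMap.congr_fun (congrArg C h) (j m')
      rw [map_add, LinearMap.add_apply, hs n, hn, j.map_app] at this
      simpa using this)
    subst hm
    have hn0 : (n : N) = 0 := by simpa using h
    exact Prod.ext rfl (Subtype.ext hn0)
  · intro x
    exact ⟨(π x, ⟨_, hmem x⟩), add_sub_cancel (j (π x)) x⟩

/-- An even symmetric form of rank two representing every functional is a hyperbolic plane. -/
theorem exists_hyperbolic_basis [Module.Free ℤ M] [Module.Finite ℤ M] {B : BilinForm ℤ M}
    (hr : Module.finrank ℤ M = 2) (hs : ∀ x y, B x y = B y x) (he : ∀ x, Even (B x x))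
    (hB : Function.Surjective B) :
    ∃ u₁ u₂ : M, B u₁ u₁ = 0 ∧ B u₂ u₂ = 0 ∧ B u₁ u₂ = 1 ∧
      ∀ x, ∃ m n : ℤ, x = m • u₁ + n • u₂ := by
  let β := Module.finBasisOfFinrankEq ℤ M hr
  have hspan : ∀ x, x = β.repr x 0 • β 0 + β.repr x 1 • β 1 := fun x => by
    conv_lhs => rw [← β.sum_repr x, Fin.sum_univ_two]
  obtain ⟨s, hs0⟩ := (he (β 0)).two_dvd
  obtain ⟨t, ht0⟩ := (he (β 1)).two_dvd
  obtain ⟨w, hw⟩ : ∃ w, B (β 0) (β 1) = w := ⟨_, rfl⟩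
  have hw' : B (β 1) (β 0) = w := by rw [hs, hw]
  have hdual : ∀ k : Fin 2, ∃ x y : ℤ, x * (2 * s) + y * w = β.coord k (β 0) ∧
      x * w + y * (2 * t) = β.coord k (β 1) := fun k => by
    obtain ⟨v, hv⟩ := hB (β.coord k)
    refine ⟨β.repr v 0, β.repr v 1, ?_, ?_⟩ <;> rw [← hv] <;> conv_rhs => rw [hspan v]
    · simp [hs0, hw']
    · simp [ht0, hw]
  obtain ⟨x, y, h1, h2⟩ := hdual 0
  obtain ⟨x', y', h3, h4⟩ := hdual 1
  simp at h1 h2 h3 h4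
  -- The vectors dual to the basis give a left inverse of the Gram matrix `(2s, w; w, 2t)`; this is
  -- the product of the determinants. Modulo 4 the determinant cannot be `+1`.
  have hdet : (x * y' - y * x') * (4 * s * t - w * w) = 1 := by
    linear_combination (x' * w + y' * (2 * t)) * h1 + h4 - (x' * (2 * s) + y' * w) * h2
  have hw1 : 4 * s * t - w * w = -1 := by
    rcases Int.isUnit_iff.1 (IsUnit.of_mul_eq_one_right _ hdet) with h | h
    · exfalso
      rcases Int.even_or_odd' w with ⟨k, rfl | rfl⟩
      · have : 4 * (s * t - k * k) = 1 := by linear_combination h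
        omega
      · have : 4 * (s * t - k * k - k) = 2 := by linear_combination h
        omega
    · exact h
  obtain ⟨h, rfl⟩ : ∃ h, w = 2 * h + 1 := by
    rcases Int.even_or_odd' w with ⟨k, rfl | rfl⟩
    · have : 4 * (s * t - k * k) = -1 := by linear_combination hw1
      omega
    · exact ⟨k, rfl⟩
  have hst : s * t = h * (h + 1) := by
    have : 4 * (s * t) = 4 * (h * (h + 1)) := by linear_combination hw1
    omega
  -- Half the form factors: `s X² + w X Y + t Y² = (g X + t' Y)(s' X + h' Y)`. The factors are
  -- unimodular coordinates, and `u₁`, `u₂` below are the basis dual to them.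
  obtain ⟨g, s', h', t', e1, e2, e3, e4⟩ := exists_factorization hst
  have e5 : s' * t' - g * h' = 1 := by rw [← e4, ← e2]; ring
  have e6 : 2 * h + 1 = g * h' + s' * t' := by rw [← e4, ← e2]; ring
  rw [e6] at hw hw'
  rw [e1] at hs0
  rw [e3] at ht0
  refine ⟨(-h') • β 0 + s' • β 1, t' • β 0 + (-g) • β 1, ?_, ?_, ?_, fun z => ?_⟩
  · simp only [map_add, map_smul, LinearMap.add_apply, LinearMap.smul_apply, smul_eq_mul, hs0, ht0,
      hw, hw']
    ring
  · simp only [map_add, map_smul, LinearMap.add_apply, LinearMap.smul_apply, smul_eq_mul, hs0, ht0,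
      hw, hw']
    ring
  · simp only [map_add, map_smul, LinearMap.add_apply, LinearMap.smul_apply, smul_eq_mul, hs0, ht0,
      hw, hw']
    linear_combination (s' * t' - g * h' + 1) * e5
  · refine ⟨g * β.repr z 0 + t' * β.repr z 1, s' * β.repr z 0 + h' * β.repr z 1, ?_⟩
    conv_lhs => rw [hspan z]
    have e7 : ∀ k : ℤ, k = (s' * t' - g * h') * k := fun k => by rw [e5, one_mul]
    generalize β.repr z 0 = m
    generalize β.repr z 1 = n
    trans ((s' * t' - g * h') * m) • β 0 + ((s' * t' - g * h') * n) • β 1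
    · rw [← e7, ← e7]
    · module

end General

/-! ### Isometries between the lattices `Λ_{b,c}` -/

section RankTwo

theorem Lam_apply (b c : ℤ) (x y : Fin 2 → ℤ) :
    Lam b c x y = b * (x 0 * y 1 + x 1 * y 0) + 2 * c * (x 1 * y 1) := by
  simp [Lam, Matrix.toBilin'_apply, Fin.sum_univ_two]
  ring

theorem U_apply (x y : Fin 2 → ℤ) : U x y = x 0 * y 1 + x 1 * y 0 := by
  simp [U, Matrix.toBilin'_apply, Fin.sum_univ_two]

/-- A form with two spanning vectors whose Gram matrix is that of `Λ_{b,d}`. -/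
theorem isometric_Lam {M : Type*} [AddCommGroup M] {B : BilinForm ℤ M} {b d : ℤ} (hb : b ≠ 0)
    (hs : ∀ x y, B x y = B y x) (t₁ t₂ : M) (h₁₁ : B t₁ t₁ = 0) (h₁₂ : B t₁ t₂ = b)
    (h₂₂ : B t₂ t₂ = 2 * d) (hspan : ∀ x, ∃ m n : ℤ, x = m • t₁ + n • t₂) :
    Isometric B (Lam b d) := by
  let e : (Fin 2 → ℤ) →ₗ[ℤ] M := Fintype.linearCombination ℤ ![t₁, t₂]
  have he : ∀ x, e x = x 0 • t₁ + x 1 • t₂ := fun x => by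
    simp [e, Fintype.linearCombination_apply]
  have h₂₁ : B t₂ t₁ = b := by rw [hs, h₁₂]
  have hiso : ∀ x y, B (e x) (e y) = Lam b d x y := fun x y => by
    simp only [he, map_add, map_smul, LinearMap.add_apply, LinearMap.smul_apply, smul_eq_mul, h₁₁,
      h₁₂, h₂₁, h₂₂, Lam_apply]
    ring
  -- Independence of `t₁`, `t₂` is automatic: the Gram determinant `-b²` is nonzero.
  have hbij : Function.Bijective e := by
    constructor
    · rw [injective_iff_map_eq_zero]
      intro x hx
      have h0 := hiso x ![1, 0]
      have h1 := hiso x ![0, 1]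
      rw [hx, Lam_apply] at h0 h1
      simp at h0 h1
      have hx1 : x 1 = 0 := by tauto
      have hx0 : x 0 = 0 := by
        rw [hx1] at h1
        simp at h1
        tauto
      ext k
      fin_cases k <;> simp [hx0, hx1]
    · intro x
      obtain ⟨m, n, rfl⟩ := hspan x
      exact ⟨![m, n], by simp [he]⟩
  refine ⟨(LinearEquiv.ofBijective e hbij).symm, fun x y => ?_⟩
  rw [← hiso]
  congr 2
  · exact (LinearEquiv.ofBijective e hbij).apply_symm_apply x
  · exact (LinearEquiv.ofBijective e hbij).apply_symm_apply y

theorem Lam_symm (b c : ℤ) (x y : Fin 2 → ℤ) : Lam b c x y = Lam b c y x := by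
  simp only [Lam_apply]
  ring

theorem isometric_Lam_neg {b : ℤ} (c : ℤ) (hb : b ≠ 0) : Isometric (Lam b c) (Lam (-b) c) := by
  refine isometric_Lam (neg_ne_zero.2 hb) (Lam_symm b c) ![-1, 0] ![0, 1] ?_ ?_ ?_ fun x =>
    ⟨-x 0, x 1, ?_⟩
  · simp [Lam_apply]
  · simp [Lam_apply]
  · simp [Lam_apply]
  · ext k
    fin_cases k <;> simp

theorem isometric_Lam_sub {b : ℤ} (c : ℤ) (hb : b ≠ 0) (n : ℤ) :
    Isometric (Lam b c) (Lam b (c - n * b)) := by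
  refine isometric_Lam hb (Lam_symm b c) ![1, 0] ![-n, 1] ?_ ?_ ?_ fun x =>
    ⟨x 0 + n * x 1, x 1, ?_⟩
  · simp [Lam_apply]
  · simp [Lam_apply]
  · simp [Lam_apply]
    ring
  · ext k
    fin_cases k
    · simp
      ring
    · simp

theorem isometric_Lam_of_dvd_sub {b c d : ℤ} (hb : b ≠ 0) (h : b ∣ c - d) :
    Isometric (Lam b c) (Lam b d) := by
  obtain ⟨n, hn⟩ := h
  have : d = c - n * b := by linear_combination -hn
  rw [this]
  exact isometric_Lam_sub c hb n

/-- Besides `(1, 0)`, the vector `(-c, b)` is isotropic, and it is primitive as `b k + c d = 1`.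
Completing it by `(k, d)` exchanges the roles of the two isotropic lines. -/
theorem isometric_Lam_of_mul_modEq_one {b c d : ℤ} (hb : b ≠ 0) (h : c * d ≡ 1 [ZMOD b]) :
    Isometric (Lam b c) (Lam b d) := by
  obtain ⟨k, hk⟩ := h.dvd
  have hk' : b * k + c * d = 1 := by linear_combination -hk
  refine isometric_Lam hb (Lam_symm b c) ![-c, b] ![k, d] ?_ ?_ ?_ fun x =>
    ⟨-d * x 0 + k * x 1, b * x 0 + c * x 1, ?_⟩
  · simp [Lam_apply]
    ring
  · simp [Lam_apply]
    linear_combination b * hk'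
  · simp [Lam_apply]
    linear_combination 2 * d * hk'
  · ext j
    fin_cases j <;> simp
    · linear_combination (-x 0) * hk'
    · linear_combination (-x 1) * hk'

/-- The image `(x, y)` of the isotropic basis vector satisfies `y (b x + d y) = 0`. On the line `y =
0` the isometry gives `b ∣ d - c`, impossible in the given range. On the other line, coprimality of
`b` and `c` gives `y = b k` with `k = ±1`, and the remaining equations yield the congruence. -/
theorem mul_modEq_one_of_isometric {b c d : ℤ} (hcop : Int.gcd b c = 1) (h0 : 0 ≤ c) (hcd : c < d)
    (hd : d ≤ b - 1) (h : Isometric (Lam b c) (Lam b d)) : c * d ≡ 1 [ZMOD b] := by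
  obtain ⟨e, he⟩ := h
  have hb : b ≠ 0 := by omega
  have h11 := he ![1, 0] ![1, 0]
  have h12 := he ![1, 0] ![0, 1]
  have h22 := he ![0, 1] ![0, 1]
  rw [Lam_apply, Lam_apply] at h11 h12 h22
  simp at h11 h12 h22
  generalize e ![1, 0] 0 = x at *
  generalize e ![1, 0] 1 = y at *
  generalize e ![0, 1] 0 = z at *
  generalize e ![0, 1] 1 = w at *
  have h11' : y * (b * x + d * y) = 0 := by
    have : 2 * (y * (b * x + d * y)) = 0 := by linear_combination h11
    simpa using this
  have h22' : w * (b * z + d * w) = c := by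
    have : 2 * (w * (b * z + d * w)) = 2 * c := by linear_combination h22
    omega
  rcases mul_eq_zero.1 h11' with hy | hy
  · subst hy
    have hxw : x * w = 1 := by
      apply mul_left_cancel₀ hb
      linear_combination h12
    have hw : w * w = 1 := by
      rcases Int.isUnit_iff.1 (IsUnit.of_mul_eq_one_right _ hxw) with rfl | rfl <;> rfl
    have hdvd : b ∣ d - c := ⟨-(w * z), by linear_combination (-d) * hw + h22'⟩
    have := Int.le_of_dvd (by omega) hdvd
    omega
  · have hyb : y * (b * z + d * w) = b := by linear_combination h12 - w * hy
    have hyc : y * c = b * w := by rw [← h22']; linear_combination w * hyb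
    obtain ⟨k, hk⟩ : b ∣ y :=
      (Int.isCoprime_iff_gcd_eq_one.2 hcop).dvd_of_dvd_mul_right ⟨w, hyc⟩
    have hk1 : k * (b * z + d * w) = 1 := by
      apply mul_left_cancel₀ hb
      linear_combination hyb - (b * z + d * w) * hk
    have hkc : k * c = w := by
      apply mul_left_cancel₀ hb
      linear_combination hyc - c * hk
    have hkk : k * k = 1 := by
      rcases Int.isUnit_iff.1 (IsUnit.of_mul_eq_one _ hk1) with rfl | rfl <;> rfl
    refine (Int.modEq_iff_dvd.2 ⟨k * z, ?_⟩)
    linear_combination (-1 : ℤ) * hk1 - k * d * hkc + c * d * hkk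

end RankTwo

/-! ### The K3 lattice is even and unimodular -/

section Unimodular

theorem isUnimodular_U : IsUnimodular U :=
  isUnimodular_toBilin' (A' := !![0, 1; 1, 0]) (by decide)

theorem isUnimodular_negE8 : IsUnimodular negE8 := by
  -- The displayed matrix is the inverse of the Cartan matrix of `E₈`.
  refine isUnimodular_toBilin' (A' := -!![
    4, 5, 7, 10, 8, 6, 4, 2;
    5, 8, 10, 15, 12, 9, 6, 3;
    7, 10, 14, 20, 16, 12, 8, 4;
    10, 15, 20, 30, 24, 18, 12, 6;
    8, 12, 16, 24, 20, 15, 10, 5;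
    6, 9, 12, 18, 15, 12, 8, 4;
    4, 6, 8, 12, 10, 8, 6, 3;
    2, 3, 4, 6, 5, 4, 3, 2]) ?_
  rw [neg_mul_neg]
  decide +kernel

theorem isUnimodular_LamK3 : IsUnimodular LamK3 :=
  isUnimodular_U.orthSum (isUnimodular_U.orthSum (isUnimodular_U.orthSum
    (isUnimodular_negE8.orthSum isUnimodular_negE8)))

theorem U_symm (x y : Fin 2 → ℤ) : U x y = U y x := by
  simp only [U_apply]
  ring

theorem negE8_symm (x y : Fin 8 → ℤ) : negE8 x y = negE8 y x := by
  have h : (-CartanMatrix.E₈).transpose = -CartanMatrix.E₈ := by decide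
  rw [negE8, Matrix.toBilin'_apply', Matrix.toBilin'_apply', Matrix.dotProduct_mulVec, ← h,
    Matrix.vecMul_transpose, h, dotProduct_comm]

theorem LamK3_symm (x y) : LamK3 x y = LamK3 y x := by
  simp only [LamK3, orthSum_apply]
  rw [U_symm x.1, U_symm x.2.1, U_symm x.2.2.1, negE8_symm x.2.2.2.1, negE8_symm x.2.2.2.2]

theorem even_U (x : Fin 2 → ℤ) : Even (U x x) :=
  ⟨x 0 * x 1, by rw [U_apply]; ring⟩

theorem even_negE8 (x : Fin 8 → ℤ) : Even (negE8 x x) := by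
  refine ⟨-(x 0 * x 0 + x 1 * x 1 + x 2 * x 2 + x 3 * x 3 + x 4 * x 4 + x 5 * x 5 + x 6 * x 6 +
    x 7 * x 7 - x 0 * x 2 - x 1 * x 3 - x 2 * x 3 - x 3 * x 4 - x 4 * x 5 - x 5 * x 6 -
    x 6 * x 7), ?_⟩
  simp [negE8, Matrix.toBilin'_apply, Fin.sum_univ_eight, CartanMatrix.E₈]
  ring

theorem even_LamK3 (x) : Even (LamK3 x x) :=
  (even_U _).add ((even_U _).add ((even_U _).add ((even_negE8 _).add (even_negE8 _))))

end Unimodular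

/-! ### The complement of an arbitrary primitive embedding -/

section Complement

/-- Solutions of `b y + q m + p n = 0` with `gcd (b, p, q) = 1`, parametrized so that the value of
`m n` on the second generator is `-a² p q` modulo `b`, with `a` a unit modulo `b`. -/
theorem exists_parametrization {b p q : ℤ} (hb : b ≠ 0)
    (hcop : ∃ y m n : ℤ, b * y + q * m + p * n = 1) :
    ∃ a r B g k : ℤ, a ≠ 0 ∧ IsCoprime a b ∧ b = g * B ∧ q = g * r ∧ a * r = 1 + k * B ∧
      ∀ y m n : ℤ, b * y + q * m + p * n = 0 →
        ∃ s t : ℤ, y = -(s * r) + t * (p * k) ∧ m = s * B - t * (a * p) ∧ n = t * g := by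
  obtain ⟨B, r, hB, hr, hu⟩ := extract_gcd b q
  set g := gcd b q
  have hg : g ≠ 0 := by
    intro hg
    rw [hg, zero_mul] at hB
    exact hb hB
  have hBr : IsCoprime B r := (gcd_isUnit_iff B r).1 hu
  obtain ⟨u, v, huv⟩ := hBr
  -- `v` inverts `r` modulo `B`; lifting it to a unit modulo all of `b` is what makes `a` coprime to
  -- `b`.
  obtain ⟨a, ha0, hab, k, hk⟩ := exists_isCoprime_lift hb ⟨g, by rw [hB, mul_comm]⟩
    (r := v) (m := B) ⟨r, u, by linear_combination huv⟩
  obtain ⟨y₀, m₀, n₀, h₀⟩ := hcop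
  have hgp : IsCoprime g p := ⟨B * y₀ + r * m₀, n₀, by
    rw [hB, hr] at h₀
    linear_combination h₀⟩
  refine ⟨a, r, B, g, k * r - u, ha0, hab, hB, hr, by linear_combination r * hk + huv, ?_⟩
  intro y m n h
  obtain ⟨t, ht⟩ : g ∣ n := hgp.dvd_of_dvd_mul_left ⟨-(B * y + r * m), by
    rw [hB, hr] at h
    linear_combination h⟩
  have hdiv : B * y + r * m + p * t = 0 := by
    apply mul_left_cancel₀ hg
    rw [hB, hr, ht] at h
    linear_combination h
  have hB0 : B ≠ 0 := by
    rintro rfl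
    exact hb (by rw [hB, mul_zero])
  obtain ⟨s, hs⟩ : B ∣ m + t * (a * p) :=
    (show IsCoprime B r from ⟨u, v, huv⟩).dvd_of_dvd_mul_left
      ⟨-y + t * p * (k * r - u), by linear_combination hdiv + t * p * (r * hk + huv)⟩
  refine ⟨s, t, ?_, by linear_combination hs, by linear_combination ht⟩
  apply mul_left_cancel₀ hB0
  linear_combination hdiv - r * hs + t * p * (r * hk + huv)

/-- The complement of a primitively embedded `Λ_{b,c} ⊕ W`, with `W` unimodular, in an even
unimodular lattice of rank `rank W + 4`. -/
theorem exists_isometric_imagePerp {P L : Type*} [AddCommGroup P] [AddCommGroup L]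
    [Module.Free ℤ P] [Module.Finite ℤ P] [Module.Free ℤ L] [Module.Finite ℤ L]
    {W : BilinForm ℤ P} {C : BilinForm ℤ L} (hW : IsUnimodular W) (hC : IsUnimodular C)
    (hs : ∀ x y, C x y = C y x) (he : ∀ x, Even (C x x))
    (hr : Module.finrank ℤ P + 4 = Module.finrank ℤ L) {b c : ℤ} (hb : b ≠ 0)
    (i : (orthSum (Lam b c) W).Isometry C) (hi : IsPrimitiveEmbedding i) :
    ∃ a : ℤ, a ≠ 0 ∧ IsCoprime a b ∧ Isometric (imagePerp i) (Lam b (-(a ^ 2 * c))) := by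
  obtain ⟨v', hv'⟩ := hi.exists_dual hC
    ((LinearMap.proj 0) ∘ₗ (LinearMap.fst ℤ (Fin 2 → ℤ) _))
  obtain ⟨w, hw⟩ := hi.exists_dual hC
    ((LinearMap.proj 1) ∘ₗ (LinearMap.fst ℤ (Fin 2 → ℤ) _))
  simp only [LinearMap.comp_apply, LinearMap.proj_apply, LinearMap.fst_apply] at hv' hw
  have hsplit : ∀ x Y, i (x, Y) = x 0 • i (![1, 0], 0) + x 1 • i (![0, 1], 0) + i (0, Y) :=
    fun x Y => by
      rw [← map_smul, ← map_smul, ← map_add, ← map_add]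
      congr 1
      refine Prod.ext ?_ (by simp)
      ext k
      fin_cases k <;> simp
  have hi0 : i (0, 0) = 0 := map_zero i
  have hgram : ∀ x Y y Z, C (i (x, Y)) (i (y, Z)) =
      Lam b c x y + W Y Z := fun x Y y Z => i.map_app _ _
  have hee : C (i (![1, 0], 0)) (i (![1, 0], 0)) = 0 := by simp [hgram, Lam_apply]
  have hef : C (i (![1, 0], 0)) (i (![0, 1], 0)) = b := by simp [hgram, Lam_apply]
  have hff : C (i (![0, 1], 0)) (i (![0, 1], 0)) = 2 * c := by
    simp [hgram, Lam_apply]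
  have heW : ∀ Z, C (i (![1, 0], 0)) (i (0, Z)) = 0 := fun Z => by
    simp [hgram]
  have hfW : ∀ Z, C (i (![0, 1], 0)) (i (0, Z)) = 0 := fun Z => by
    simp [hgram]
  have hWW : ∀ Z Z', C (i (0, Z)) (i (0, Z')) = W Z Z' := fun Z Z' => by
    simp [hgram]
  have hve : C v' (i (![1, 0], 0)) = 1 := by simp [hv']
  have hvW : ∀ Z, C v' (i (0, Z)) = 0 := fun Z => by simp [hv']
  have hwe : C w (i (![1, 0], 0)) = 0 := by simp [hw]
  have hwf : C w (i (![0, 1], 0)) = 1 := by simp [hw]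
  have hwW : ∀ Z, C w (i (0, Z)) = 0 := fun Z => by simp [hw]
  set e := i (![1, 0], 0)
  set f := i (![0, 1], 0)
  obtain ⟨k, hk⟩ := (he v').two_dvd
  -- Subtracting half the square of `v'` times `e` makes the vector isotropic, since `e` is
  -- isotropic and pairs to 1 with `v'`.
  obtain ⟨v, hv⟩ : ∃ v, v = v' - k • e := ⟨_, rfl⟩
  have hev' : C e v' = 1 := by rw [hs, hve]
  have hve : C v e = 1 := by simp [hv, hve, hee]
  have hev : C e v = 1 := by rw [hs, hve]
  have hvW : ∀ Z, C v (i (0, Z)) = 0 := fun Z => by simp [hv, hvW, heW]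
  have hvv : C v v = 0 := by
    have : C v v = C v v' - k * C v e := by
      nth_rw 2 [hv]
      simp
    have hvv' : C v v' = k := by
      simp [hv, hk, hev']
      ring
    rw [this, hve, hvv', mul_one, sub_self]
  have hWe : ∀ Z, C (i (0, Z)) e = 0 := fun Z => by rw [hs, heW]
  have hWv : ∀ Z, C (i (0, Z)) v = 0 := fun Z => by rw [hs, hvW]
  let j : (orthSum U W).Isometry C :=
    { toLinearMap := (Fintype.linearCombination ℤ ![e, v]).coprod
        (i.toLinearMap ∘ₗ LinearMap.inr ℤ _ _)
      map_app' := by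
        rintro ⟨x, Y⟩ ⟨y, Z⟩
        change C (Fintype.linearCombination ℤ ![e, v] x + i (0, Y))
          (Fintype.linearCombination ℤ ![e, v] y + i (0, Z)) = _
        simp only [Fintype.linearCombination_apply, Fin.sum_univ_two, Matrix.cons_val_zero,
          Matrix.cons_val_one, map_add, map_smul, LinearMap.add_apply, LinearMap.smul_apply,
          smul_eq_mul, hee, hev, hve, hvv, heW, hWe, hvW, hWv, hWW]
        rw [orthSum_apply, U_apply]
        ring }
  have hj : ∀ x Y, j (x, Y) = x 0 • e + x 1 • v + i (0, Y) := fun x Y => by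
    change Fintype.linearCombination ℤ ![e, v] x + i (0, Y) = _
    simp [Fintype.linearCombination_apply]
  have hjU := isUnimodular_U.orthSum hW
  have hrank := finrank_add_finrank_orthogonal hjU hs j
  rw [Module.finrank_prod, Module.finrank_fin_fun] at hrank
  obtain ⟨⟨u₁, hu₁⟩, ⟨u₂, hu₂⟩, h₁₁, h₂₂, h₁₂, hspan⟩ := exists_hyperbolic_basis
    (B := C.restrict (C.orthogonal (LinearMap.range j.toLinearMap))) (by omega)
    (fun x y => hs x y) (fun x => he x)
    (restrict_orthogonal_surjective hjU hC hs j)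
  change C u₁ u₁ = 0 at h₁₁
  change C u₂ u₂ = 0 at h₂₂
  change C u₁ u₂ = 1 at h₁₂
  have h₂₁ : C u₂ u₁ = 1 := by rw [hs, h₁₂]
  have hperp : ∀ u ∈ C.orthogonal (LinearMap.range j.toLinearMap),
      C e u = 0 ∧ C v u = 0 ∧ ∀ Z, C (i (0, Z)) u = 0 := fun u hu => by
    rw [mem_orthogonal_range] at hu
    refine ⟨?_, ?_, fun Z => ?_⟩
    · simpa [hj, hi0] using hu (![1, 0], 0)
    · simpa [hj, hi0] using hu (![0, 1], 0)
    · simpa [hj] using hu (0, Z)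
  obtain ⟨heu₁, hvu₁, hWu₁⟩ := hperp u₁ hu₁
  obtain ⟨heu₂, hvu₂, hWu₂⟩ := hperp u₂ hu₂
  have hue₁ : C u₁ e = 0 := by rw [hs, heu₁]
  have hue₂ : C u₂ e = 0 := by rw [hs, heu₂]
  have huv₁ : C u₁ v = 0 := by rw [hs, hvu₁]
  have huv₂ : C u₂ v = 0 := by rw [hs, hvu₂]
  -- The lattice is `⟨e, v⟩ ⊕ W ⊕ ⟨u₁, u₂⟩`; orthogonality to `W` kills the middle component, and
  -- pairing with `e` reads off the coefficient of `v`.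
  have hcoord : ∀ x, (∀ Z, C x (i (0, Z)) = 0) → ∃ y m n : ℤ,
      x = y • e + C x e • v + m • u₁ + n • u₂ := fun x hx => by
    obtain ⟨π, hπ, hmem⟩ := exists_orthogonal_projection hjU hs j
    obtain ⟨m, n, hmn⟩ := hspan ⟨_, hmem x⟩
    have hmn' : x - j (π x) = m • u₁ + n • u₂ := congrArg Subtype.val hmn
    have hπ2 : (π x).2 = 0 := hW.1 (LinearMap.ext fun Z => by
      have := hπ x (0, Z)
      rw [hj, orthSum_apply] at this
      simp [hx] at this
      rw [map_zero, LinearMap.zero_apply]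
      exact this.symm)
    have hπ1 : C x e = (π x).1 1 := by
      have := hπ x (![1, 0], 0)
      rw [hj, orthSum_apply, U_apply, hi0] at this
      simpa using this
    refine ⟨(π x).1 0, m, n, ?_⟩
    have hx' : x = j (π x) + (m • u₁ + n • u₂) := by rw [← hmn']; abel
    have hjx : j (π x) = (π x).1 0 • e + (π x).1 1 • v := by
      have := hj (π x).1 (π x).2
      rw [hπ2, hi0, add_zero, ← hπ2] at this
      exact this
    rw [hjx, ← hπ1] at hx'
    rw [add_assoc]
    exact hx'
  obtain ⟨ν, p, q, hf⟩ := hcoord f hfW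
  rw [hs f e, hef] at hf
  obtain ⟨y₀, m₀, n₀, hw₀⟩ := hcoord w hwW
  rw [hwe, zero_smul, add_zero] at hw₀
  have hgen : ∀ y m n : ℤ,
      C (y • e + m • u₁ + n • u₂) f = b * y + q * m + p * n := fun y m n => by
    rw [hf]
    simp [hee, hev, heu₁, heu₂, hue₁, hue₂, huv₁, huv₂, h₁₁, h₂₂, h₁₂, h₂₁]
    ring
  have hc : c = b * ν + p * q := by
    rw [hf] at hff
    simp [hee, hev, hve, hvv, hvu₁, hvu₂, heu₁, heu₂, hue₁, hue₂, huv₁, huv₂, h₁₁, h₂₂, h₁₂,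
      h₂₁] at hff
    have : 2 * c = 2 * (b * ν + p * q) := by linear_combination -hff
    omega
  -- The vector `w` is orthogonal to `e` and pairs to 1 with `f`, which is a Bézout relation for
  -- `b`, `q`, `p`.
  obtain ⟨a, r, B, g, k', ha0, hab, hbB, hqr, har, hsol⟩ := exists_parametrization (p := p) (q := q)
    hb ⟨y₀, m₀, n₀, by rw [← hgen, ← hw₀, hwf]⟩
  -- The generators `(-r, B, 0)` and `(p k', -a p, g)` give the parameter `-a p g`. As `a r ≡ 1`
  -- modulo `B`, one has `a q ≡ g` modulo `b`, so `a p g ≡ a² p q ≡ a² c`.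
  refine ⟨a, ha0, hab, Isometric.trans (C := Lam b (-(a * p * g))) ?_
    (isometric_Lam_of_dvd_sub hb ⟨a ^ 2 * ν + a * p * k', ?_⟩)⟩
  · have hT : ∀ y m n : ℤ, b * y + q * m + p * n = 0 → y • e + m • u₁ + n • u₂ ∈
        C.orthogonal (LinearMap.range i.toLinearMap) := fun y m n h => by
      rw [mem_orthogonal_range]
      rintro ⟨x, Y⟩
      rw [hs, hsplit, map_add, map_add, map_smul, map_smul, hgen, h]
      have h1 : C u₁ (i (0, Y)) = 0 := by rw [hs, hWu₁]
      have h2 : C u₂ (i (0, Y)) = 0 := by rw [hs, hWu₂]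
      simp [hee, hue₁, hue₂, heW, h1, h2]
    refine isometric_Lam hb (fun x y => hs x y)
      ⟨_, hT (-r) B 0 (by rw [hbB, hqr]; ring)⟩
      ⟨_, hT (p * k') (-(a * p)) g (by rw [hqr, hbB]; linear_combination (-p * g) * har)⟩
      ?_ ?_ ?_ ?_
    · change C _ _ = 0
      simp [hee, heu₁, hue₁, h₁₁]
    · change C _ _ = b
      simp [hee, heu₁, heu₂, hue₁, h₁₁, h₁₂]
      rw [hbB, mul_comm]
    · change C _ _ = _
      simp [hee, heu₁, heu₂, hue₁, hue₂, h₁₁, h₁₂, h₂₁, h₂₂]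
      ring
    · rintro ⟨x, hx⟩
      rw [mem_orthogonal_range] at hx
      obtain ⟨y, m, n, hxe⟩ := hcoord x fun Z => by rw [hs]; exact hx _
      have hxe0 : C x e = 0 := by rw [hs]; exact hx _
      have hxf : C x f = 0 := by rw [hs]; exact hx _
      rw [hxe0, zero_smul, add_zero] at hxe
      rw [hxe, hgen] at hxf
      obtain ⟨s, t, hy, hm, hn⟩ := hsol y m n hxf
      refine ⟨s, t, Subtype.ext ?_⟩
      change x = s • ((-r) • e + B • u₁ + (0 : ℤ) • u₂) +
        t • ((p * k') • e + (-(a * p)) • u₁ + g • u₂)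
      rw [hxe, hy, hm, hn]
      module
  · rw [hc, hqr]
    linear_combination (a * p * g) * har - a * p * k' * hbB

end Complement

/-! ### Construction of primitive embeddings with prescribed complement -/

section Embedding

variable {P : Type*} [AddCommGroup P] (W : BilinForm ℤ P)

/-- The embedding `Λ_{b,c} ⊕ W → U ⊕ U ⊕ W` sending the basis of `Λ_{b,c}` to
`(1, 0; 0, 0)` and `(ν, b; p, q)`, where `c = b ν + p q`. -/
def lamEmbedding {b c : ℤ} (ν p q : ℤ) (hc : c = b * ν + p * q) :
    (orthSum (Lam b c) W).Isometry (orthSum U (orthSum U W)) where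
  toLinearMap := (Fintype.linearCombination ℤ ![![1, 0], ![ν, b]] ∘ₗ LinearMap.fst ℤ _ _).prod
    ((Fintype.linearCombination ℤ ![0, ![p, q]] ∘ₗ LinearMap.fst ℤ _ _).prod
      (LinearMap.snd ℤ _ _))
  map_app' := by
    rintro ⟨x, Y⟩ ⟨y, Z⟩
    subst hc
    simp [U_apply, Lam_apply, Fintype.linearCombination_apply]
    ring

theorem lamEmbedding_apply {b c : ℤ} (ν p q : ℤ) (hc : c = b * ν + p * q) (x : Fin 2 → ℤ) (Y : P) :
    lamEmbedding W ν p q hc (x, Y) =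
      (![x 0 + x 1 * ν, x 1 * b], ![x 1 * p, x 1 * q], Y) := by
  refine Prod.ext ?_ (Prod.ext ?_ rfl)
  · change Fintype.linearCombination ℤ ![![1, 0], ![ν, b]] x = _
    ext k
    fin_cases k <;> simp [Fintype.linearCombination_apply]
  · change Fintype.linearCombination ℤ ![0, ![p, q]] x = _
    ext k
    fin_cases k <;> simp [Fintype.linearCombination_apply]

variable {W}

theorem isPrimitiveEmbedding_lamEmbedding {b c ν p q : ℤ} (hc : c = b * ν + p * q)
    (hb : b ≠ 0) (hbq : IsCoprime b q) : IsPrimitiveEmbedding (lamEmbedding W ν p q hc) := by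
  constructor
  · rw [injective_iff_map_eq_zero]
    rintro ⟨x, Y⟩ h
    rw [lamEmbedding_apply] at h
    simp [hb] at h
    obtain ⟨⟨h0, h1⟩, -, rfl⟩ := h
    rw [h1] at h0
    refine Prod.ext ?_ rfl
    ext k
    fin_cases k
    · simpa using h0
    · simpa using h1
  · refine Module.IsTorsionFree.of_smul_eq_zero fun n z hz => ?_
    obtain ⟨⟨z, u, Y⟩, rfl⟩ := Submodule.mkQ_surjective _ z
    rw [← map_smul, ← LinearMap.mem_ker, Submodule.ker_mkQ] at hz
    rw [← LinearMap.mem_ker, Submodule.ker_mkQ]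
    obtain ⟨⟨x, Z⟩, hx⟩ := hz
    replace hx : lamEmbedding W ν p q hc (x, Z) = n • (z, u, Y) := hx
    rw [lamEmbedding_apply] at hx
    have h1 := congrFun (congrArg (fun t => t.1) hx) 0
    have h2 := congrFun (congrArg (fun t => t.1) hx) 1
    have h3 := congrFun (congrArg (fun t => t.2.1) hx) 0
    have h4 := congrFun (congrArg (fun t => t.2.1) hx) 1
    simp at h1 h2 h3 h4
    refine or_iff_not_imp_left.2 fun hn => ?_
    obtain ⟨s, t, hst⟩ := hbq
    -- The coordinates `x 1 * b` and `x 1 * q` are divisible by `n`, hence so is `x 1` by the Bézout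
    -- relation; `y` is the quotient.
    obtain ⟨y, hy⟩ : ∃ y, y = s * z 1 + t * u 1 := ⟨_, rfl⟩
    have hxy : x 1 = n * y := by
      rw [hy]
      linear_combination (-x 1) * hst + s * h2 + t * h4
    rw [hxy] at h1 h2 h3 h4
    refine ⟨(![z 0 - y * ν, y], Y), ?_⟩
    change lamEmbedding W ν p q hc _ = _
    rw [lamEmbedding_apply]
    refine Prod.ext ?_ (Prod.ext ?_ rfl)
    · ext k
      fin_cases k
      · simp
      · refine mul_left_cancel₀ hn ?_
        change n * (y * b) = n * z 1
        linear_combination h2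
    · ext k
      fin_cases k
      · refine mul_left_cancel₀ hn ?_
        change n * (y * p) = n * u 0
        linear_combination h3
      · refine mul_left_cancel₀ hn ?_
        change n * (y * q) = n * u 1
        linear_combination h4

theorem mem_orthogonal_lamEmbedding (hW : IsUnimodular W) (hs : ∀ x y, W x y = W y x)
    {b c ν p q : ℤ} (hc : c = b * ν + p * q) {z u : Fin 2 → ℤ} {Y : P} :
    (z, u, Y) ∈ (orthSum U (orthSum U W)).orthogonal
        (LinearMap.range (lamEmbedding W ν p q hc).toLinearMap) ↔
      z 1 = 0 ∧ b * z 0 + q * u 0 + p * u 1 = 0 ∧ Y = 0 := by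
  rw [mem_orthogonal_range]
  constructor
  · intro h
    have h1 := h (![1, 0], 0)
    have h2 := h (![0, 1], 0)
    have h3 := fun Z => h (0, Z)
    simp [lamEmbedding_apply, U_apply] at h1 h2 h3
    refine ⟨h1, ?_, hW.1 (LinearMap.ext fun Z => ?_)⟩
    · rw [h1] at h2
      linear_combination h2
    · rw [hs, h3]
      simp
  · rintro ⟨h1, h2, rfl⟩ ⟨x, Z⟩
    simp [lamEmbedding_apply, U_apply, h1]
    linear_combination x 1 * h2

/-- For `a` a unit modulo `b`, the lattice `Λ_{b,-a²c}` is the orthogonal complement of a primitive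
embedding. -/
theorem exists_primitive_embedding (hW : IsUnimodular W) (hs : ∀ x y, W x y = W y x)
    {a b : ℤ} (c : ℤ) (hb : b ≠ 0) (hab : IsCoprime a b) :
    ∃ i : (orthSum (Lam b c) W).Isometry (orthSum U (orthSum U W)),
      IsPrimitiveEmbedding i ∧ Isometric (imagePerp i) (Lam b (-(a ^ 2 * c))) := by
  obtain ⟨q, k, hk⟩ := hab
  have hc : c = b * (k * c) + a * c * q := by linear_combination (-c) * hk
  refine ⟨lamEmbedding W (k * c) (a * c) q hc,
    isPrimitiveEmbedding_lamEmbedding hc hb ⟨k, a, by linear_combination hk⟩, ?_⟩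
  have hmem : ∀ y m n : ℤ, b * y + q * m + a * c * n = 0 → (![y, 0], ![m, n], (0 : P)) ∈
      (orthSum U (orthSum U W)).orthogonal
        (LinearMap.range (lamEmbedding W (k * c) (a * c) q hc).toLinearMap) := fun y m n h =>
    (mem_orthogonal_lamEmbedding hW hs hc).2 (by simpa using h)
  refine isometric_Lam hb (fun x y => ?_) ⟨_, hmem (-q) b 0 (by ring)⟩
    ⟨_, hmem (-(a * c * k)) (-(a ^ 2 * c)) 1 (by linear_combination (-(a * c)) * hk)⟩ ?_ ?_ ?_ ?_
  · change orthSum U (orthSum U W) x y = orthSum U (orthSum U W) y x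
    simp only [orthSum_apply]
    rw [U_symm, U_symm x.1.2.1, hs]
  · change orthSum U (orthSum U W) _ _ = _
    simp [U_apply]
  · change orthSum U (orthSum U W) _ _ = _
    simp [U_apply]
  · change orthSum U (orthSum U W) _ _ = _
    simp [U_apply]
    ring
  · rintro ⟨⟨z, u, Y⟩, hx⟩
    obtain ⟨h1, h2, rfl⟩ := (mem_orthogonal_lamEmbedding hW hs hc).1 hx
    -- Multiply the equation of the complement by `a` and reduce with `q a + k b = 1`.
    obtain ⟨s, hsm⟩ : ∃ s, u 0 + u 1 * (a ^ 2 * c) = b * s :=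
      ⟨a * (-z 0 - k * a * c * u 1) + k * (u 0 + u 1 * (a ^ 2 * c)), by
        linear_combination a * h2 - (u 0 + a ^ 2 * c * u 1) * hk + (a ^ 2 * c * u 1) * hk⟩
    refine ⟨s, u 1, Subtype.ext ?_⟩
    change (z, u, (0 : P)) = s • (![-q, 0], ![b, 0], (0 : P)) +
      u 1 • (![-(a * c * k), 0], ![-(a ^ 2 * c), 1], (0 : P))
    refine Prod.ext ?_ (Prod.ext ?_ (by simp))
    · ext j
      fin_cases j
      · simp
        refine mul_left_cancel₀ hb ?_
        linear_combination h2 - q * hsm + a * c * u 1 * hk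
      · simp [h1]
    · ext j
      fin_cases j
      · simp
        linear_combination hsm
      · simp

/-- The lattice `Λ_{b,-a²c}` is the orthogonal complement of a primitive embedding for
every `a` with `gcd (b, a c) = gcd (b, c)`. -/
theorem exists_primitive_embedding_of_gcd_eq (hW : IsUnimodular W) (hs : ∀ x y, W x y = W y x)
    {a b c : ℤ} (hb : b ≠ 0) (hgcd : Int.gcd b (a * c) = Int.gcd b c) :
    ∃ i : (orthSum (Lam b c) W).Isometry (orthSum U (orthSum U W)),
      IsPrimitiveEmbedding i ∧ Isometric (imagePerp i) (Lam b (-(a ^ 2 * c))) := by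
  obtain ⟨g, hg⟩ : ∃ g, Int.gcd b c = g := ⟨_, rfl⟩
  obtain ⟨B, hB⟩ : (g : ℤ) ∣ b := hg ▸ Int.gcd_dvd_left b c
  obtain ⟨m, hm⟩ : (g : ℤ) ∣ c := hg ▸ Int.gcd_dvd_right b c
  have hg0 : g ≠ 0 := by
    rintro rfl
    exact hb (by simpa using hB)
  have haB : IsCoprime a B := by
    have h : g * Int.gcd B (a * m) = g * 1 := by
      rw [mul_one, ← Int.natAbs_natCast g, ← Int.gcd_mul_left, Int.natAbs_natCast, ← hB,
        mul_left_comm, ← hm, hgcd, hg]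
    exact ((Int.isCoprime_iff_gcd_eq_one.2
      (Nat.eq_of_mul_eq_mul_left (Nat.pos_of_ne_zero hg0) h)).of_mul_right_left).symm
  -- Only `a` modulo `B = b / g` matters: as `g ∣ c`, replacing `a` by a congruent unit `a'` modulo
  -- `b` changes `a² c` by a multiple of `b`.
  obtain ⟨a', -, ha'b, k, hk⟩ := exists_isCoprime_lift hb ⟨g, by rw [mul_comm, ← hB]⟩ haB
  obtain ⟨i, hi, hiso⟩ := exists_primitive_embedding hW hs c hb ha'b
  refine ⟨i, hi, hiso.trans (isometric_Lam_of_dvd_sub hb ⟨-(k * (a' + a) * m), ?_⟩)⟩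
  rw [hm, hB]
  linear_combination (-(a' + a) * g * m) * hk

end Embedding

end K3Lattice

theorem proposition3p7 :
    -- orthogonal complements of primitive embeddings, and the converse
    (∀ b c : ℤ, b ≠ 0 →
      (∀ i : (K3Lattice.Gam b c).Isometry K3Lattice.LamK3, K3Lattice.IsPrimitiveEmbedding i →
        ∃ a : ℤ, a ≠ 0 ∧ IsCoprime a b ∧
          K3Lattice.Isometric (K3Lattice.imagePerp i) (K3Lattice.Lam b (-(a ^ 2 * c)))) ∧
      (∀ a : ℤ, a ≠ 0 → Int.gcd b (a * c) = Int.gcd b c →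
        ∃ i : (K3Lattice.Gam b c).Isometry K3Lattice.LamK3, K3Lattice.IsPrimitiveEmbedding i ∧
          K3Lattice.Isometric (K3Lattice.imagePerp i) (K3Lattice.Lam b (-(a ^ 2 * c))))) ∧
    -- isometries between the lattices `Λ_{b,c}`
    (∀ b c : ℤ, b ≠ 0 →
      K3Lattice.Isometric (K3Lattice.Lam b c) (K3Lattice.Lam (-b) c) ∧
      (∀ n : ℤ, K3Lattice.Isometric (K3Lattice.Lam b c) (K3Lattice.Lam b (c - n * b))) ∧
      (∀ d : ℤ, c * d ≡ 1 [ZMOD b] →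
        K3Lattice.Isometric (K3Lattice.Lam b c) (K3Lattice.Lam b d))) ∧
    -- classification for coprime parameters
    (∀ b c d : ℤ, Int.gcd b c = 1 → 0 ≤ c → c < d → d ≤ b - 1 →
      (K3Lattice.Isometric (K3Lattice.Lam b c) (K3Lattice.Lam b d) ↔ c * d ≡ 1 [ZMOD b])) := by
  have hW := K3Lattice.isUnimodular_U.orthSum
    (K3Lattice.isUnimodular_negE8.orthSum K3Lattice.isUnimodular_negE8)
  refine ⟨fun b c hb => ⟨fun i hi => ?_, fun a _ hgcd => ?_⟩, fun b c hb => ⟨?_, ?_, ?_⟩,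
    fun b c d hbc h0 hcd hd => ⟨?_, ?_⟩⟩
  · exact K3Lattice.exists_isometric_imagePerp hW K3Lattice.isUnimodular_LamK3
      K3Lattice.LamK3_symm K3Lattice.even_LamK3 (by simp) hb i hi
  · refine K3Lattice.exists_primitive_embedding_of_gcd_eq hW (fun x y => ?_) hb hgcd
    simp only [K3Lattice.orthSum_apply]
    rw [K3Lattice.U_symm, K3Lattice.negE8_symm, K3Lattice.negE8_symm x.2.2]
  · exact K3Lattice.isometric_Lam_neg c hb
  · exact K3Lattice.isometric_Lam_sub c hb
  · exact fun d => K3Lattice.isometric_Lam_of_mul_modEq_one hb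
  · exact K3Lattice.mul_modEq_one_of_isometric hbc h0 hcd hd
  · exact K3Lattice.isometric_Lam_of_mul_modEq_one (by omega)
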